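/- Let $\mathbb{F}$ be a field of characteristic zero and let $\mathfrak{L}$ be a finite-dimensional left Leibniz algebra over $\mathbb{F}$, i.e. a finite-dimensional $\mathbb{F}$-vector space with a bilinear multiplication satisfying $x(yz)=(xy)z+y(xz)$ for all $x,y,z\in\mathfrak{L}$. Let $\mathrm{Leib}(\mathfrak{L})$ be the linear span of all squares $x^2=xx$, $x\in\mathfrak{L}$, and let $\mathrm{Rad}(\mathfrak{L})$ be the largest solvable (two-sided) ideal of $\mathfrak{L}$. Suppose that $\mathfrak{L}$ is semi-simple, i.e. that $\mathrm{Leib}(\mathfrak{L})$ contains every solvable ideal of $\mathfrak{L}$. Call a subalgebra $\mathfrak{s}$ of $\mathfrak{L}$ a Levi subalgebra if $\mathfrak{s}$ is a semi-simple Lie algebra (i.e. a Lie algebra without non-zero solvable ideals; $\mathfrak{s}=0$ is allowed) and $\mathfrak{L}=\mathfrak{s}\oplus\mathrm{Rad}(\mathfrak{L})$ as vector spaces. Then $\mathfrak{L}$ has a Levi subalgebra, and for every Levi subalgebra $\mathfrak{s}$ of $\mathfrak{L}$, setting $\mathfrak{L}_{\overline{0}}:=\mathfrak{s}$ and $\mathfrak{L}_{\overline{1}}:=\mathrm{Leib}(\mathfrak{L})$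 makes $\mathfrak{L}$ a $\mathbb{Z}/2\mathbb{Z}$-graded algebra: $\mathfrak{L}=\mathfrak{L}_{\overline{0}}\oplus\mathfrak{L}_{\overline{1}}$ as vector spaces and $\mathfrak{L}_{i}\mathfrak{L}_{j}\subseteq\mathfrak{L}_{i+j}$ for all $i,j\in\mathbb{Z}/2\mathbb{Z}$. -/

import Mathlib

/-! Nonassociative algebras over a field `F` are `NonUnitalNonAssocRing`s `L` which are `F`-modules
with `F`-bilinear multiplication (`SMulCommClass F L L`, `IsScalarTower F L L`). -/

namespace LeibnizAlgebra

/-- The left Leibniz identity: every left multiplication operator is a derivation. -/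
class IsLeftLeibniz (L : Type*) [NonUnitalNonAssocRing L] : Prop where
  leibniz : ∀ x y z : L, x * (y * z) = (x * y) * z + y * (x * z)

section

variable (F : Type*) [Field F] (L : Type*) [NonUnitalNonAssocRing L] [Module F L]

/-- The Leibniz kernel: the linear span of all squares. -/
def leib : Submodule F L := Submodule.span F {a | ∃ x : L, a = x * x}

variable {F L}

/-- The product `A B` of two subspaces: the linear span of all products `a * b`. -/
def prodSpan (A B : Submodule F L) : Submodule F L :=
  Submodule.span F {c | ∃ a ∈ A, ∃ b ∈ B, c = a * b}

/-- The derived series `A^(0) = A`, `A^(n+1) = A^(n) A^(n)`. -/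
def derivedSeries (A : Submodule F L) : ℕ → Submodule F L
  | 0 => A
  | n + 1 => prodSpan (derivedSeries A n) (derivedSeries A n)

/-- `A` is solvable: its derived series reaches zero. -/
def IsSolvable (A : Submodule F L) : Prop := ∃ n : ℕ, derivedSeries A n = ⊥

/-- Two-sided ideals. -/
def IsIdeal (I : Submodule F L) : Prop :=
  ∀ a ∈ I, ∀ x : L, x * a ∈ I ∧ a * x ∈ I

variable (F L)

/-- Semi-simple: the Leibniz kernel contains every solvable ideal. -/
def IsSemisimple : Prop :=
  ∀ I : Submodule F L, IsIdeal I → IsSolvable I → I ≤ leib F L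

/-- The radical: the sum of all solvable ideals (for a finite-dimensional left Leibniz algebra,
the largest solvable ideal). -/
def radical : Submodule F L := sSup {I | IsIdeal I ∧ IsSolvable I}

variable {F L}

/-- A Levi subalgebra: a subalgebra which is a semi-simple Lie algebra and is a vector space
complement of the radical. For a subalgebra of a left Leibniz algebra, being a Lie algebra means
that all squares vanish. -/
def IsLeviSubalgebra [SMulCommClass F L L] [IsScalarTower F L L]
    (s : NonUnitalSubalgebra F L) : Prop :=
  (∀ x ∈ s, x * x = 0) ∧ IsSemisimple F s ∧ IsCompl s.toSubmodule (radical F L)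

/-- A `ℤ/2ℤ`-grading of the algebra: `L` is the internal direct sum of the subspaces `𝒜 0` and
`𝒜 1`, and `𝒜 i * 𝒜 j ⊆ 𝒜 (i + j)`. -/
def IsZ2Grading (𝒜 : ZMod 2 → Submodule F L) : Prop :=
  DirectSum.IsInternal 𝒜 ∧ ∀ i j : ZMod 2, ∀ a ∈ 𝒜 i, ∀ b ∈ 𝒜 j, a * b ∈ 𝒜 (i + j)

end

end LeibnizAlgebra

/-! Leib(L) annihilates L from the left, and semisimplicity makes it exactly the kernel of x ↦ (left
multiplication by x). The image of this map is a Lie algebra G of operators with trivial radical,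
and L → G is a surjection of G-modules with kernel Leib(L). Whitehead's first lemma
(`IsOneCocycle.exists_eq_lie`), applied to Hom(G, Leib(L)), yields an equivariant section τ; since
τ(g)τ(h) = ⁅g, τ h⁆ = τ⁅g, h⁆, its range is a subalgebra complementing Leib(L) = Rad(L), hence a
Levi subalgebra. The grading rules only need that Leib(L) is an ideal annihilating L from the left.
-/

namespace LieAlgebra

/-! ### Perfect ideals and invariant tensors. -/

open LieModule Module

variable {F G : Type*} [Field F] [LieRing G] [LieAlgebra F G]

/-- In a Lie algebra with non-degenerate Killing form every ideal is perfect. -/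
theorem IsKilling.lie_ideal_self [FiniteDimensional F G] [IsKilling F G] (I : LieIdeal F G) :
    ⁅I, I⁆ = I := by
  set D : LieIdeal F G := ⁅I, I⁆ with hD
  have hDI : D ≤ I := LieSubmodule.lie_le_left I I
  have hc := D.isCompl_killingCompl
  have hab : I ⊓ D.killingCompl = ⊥ := by
    have : IsLieAbelian (I ⊓ D.killingCompl : LieIdeal F G) := by
      rw [LieSubmodule.lie_abelian_iff_lie_self_eq_bot, LieSubmodule.lie_eq_bot_iff]
      intro x hx y hy
      have h1 : ⁅x, y⁆ ∈ D := LieSubmodule.lie_mem_lie hx.1 hy.1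
      have h2 : ⁅x, y⁆ ∈ D.killingCompl := lie_mem_right F G _ x y hy.2
      simpa [hc.inf_eq_bot] using show ⁅x, y⁆ ∈ D ⊓ D.killingCompl from ⟨h1, h2⟩
    exact IsKilling.ideal_eq_bot_of_isLieAbelian _
  refine le_antisymm hDI ?_
  calc I = I ⊓ (D ⊔ D.killingCompl) := by rw [hc.sup_eq_top, inf_top_eq]
    _ = D ⊔ I ⊓ D.killingCompl := by
      rw [inf_comm, sup_inf_assoc_of_le _ hDI, inf_comm I]
    _ ≤ D := by rw [hab, sup_bot_eq]

/-- The canonical tensor of a non-degenerate invariant symmetric form is invariant. -/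
theorem sum_dualBasis_lie_eq_zero {N V ι : Type*} [AddCommGroup N] [Module F N]
    [LieRingModule G N] [LieModule F G N] [FiniteDimensional F N] [AddCommGroup V] [Module F V]
    [Fintype ι] [DecidableEq ι] {B : LinearMap.BilinForm F N} (hB : B.Nondegenerate)
    (hsymm : B.IsSymm) (hinv : B.lieInvariant G) (b : Module.Basis ι F N) (β : N →ₗ[F] N →ₗ[F] V)
    (g : G) :
    ∑ i, (β ⁅g, b i⁆ (B.dualBasis hB b i) + β (b i) ⁅g, B.dualBasis hB b i⁆) = 0 := by
  set d := B.dualBasis hB b with hd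
  have hdd : B.dualBasis hB d = b := B.dualBasis_dualBasis hB hsymm b
  have h1 (x : N) : x = ∑ j, B x (d j) • b j := by
    conv_lhs => rw [← b.sum_repr x]
    refine Finset.sum_congr rfl fun j _ ↦ ?_
    rw [← B.dualBasis_repr_apply hB d x j, hdd]
  have h2 (x : N) : x = ∑ j, B x (b j) • d j := by
    conv_lhs => rw [← d.sum_repr x]
    simp [hd, LinearMap.BilinForm.dualBasis_repr_apply]
  have e1 (i : ι) : β ⁅g, b i⁆ (d i) = ∑ j, B ⁅g, b i⁆ (d j) • β (b j) (d i) := by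
    conv_lhs => rw [h1 ⁅g, b i⁆]
    simp
  have e2 (i : ι) : β (b i) ⁅g, d i⁆ = ∑ j, B ⁅g, d i⁆ (b j) • β (b i) (d j) := by
    conv_lhs => rw [h2 ⁅g, d i⁆]
    simp
  simp_rw [e1, e2]
  rw [Finset.sum_add_distrib]
  nth_rw 2 [Finset.sum_comm]
  rw [← Finset.sum_add_distrib]
  refine Finset.sum_eq_zero fun i _ ↦ ?_
  rw [← Finset.sum_add_distrib]
  refine Finset.sum_eq_zero fun j _ ↦ ?_
  -- Invariance: the matrices of `g` in the dual bases are negative transposes, so the two sums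
  -- cancel termwise.
  have : B ⁅g, d j⁆ (b i) = -B ⁅g, b i⁆ (d j) := by
    rw [hinv g (d j), hsymm.eq (d j) ⁅g, b i⁆]
  rw [this, neg_smul, add_neg_cancel]

/-! ### Casimir operators and 1-cocycles. -/

section Casimir

variable {V ι : Type*} [AddCommGroup V] [Module F V] [LieRingModule G V] [LieModule F G V]
  [Fintype ι]

/-- A 1-cocycle of a Lie algebra with values in a module, i.e. a derivation into the module. -/
def IsOneCocycle (f : G →ₗ[F] V) : Prop := ∀ x y : G, f ⁅x, y⁆ = ⁅x, f y⁆ - ⁅y, f x⁆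

/-- The operator `∑ xᵢ yᵢ` on a module. -/
noncomputable def casimir (F V : Type*) [Field F] [LieAlgebra F G] [AddCommGroup V] [Module F V]
    [LieRingModule G V] [LieModule F G V] (x y : ι → G) : V →ₗ[F] V :=
  ∑ i, toEnd F G V (x i) ∘ₗ toEnd F G V (y i)

theorem casimir_apply (x y : ι → G) (v : V) : casimir F V x y v = ∑ i, ⁅x i, ⁅y i, v⁆⁆ := by
  simp [casimir]

/-- Evaluate the invariant tensor on β(a, b) = ⁅a, ⁅b, v⁆⁆. -/
theorem lie_casimir {x y : ι → G} (g : G)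
    (h : ∀ β : G →ₗ[F] G →ₗ[F] V, ∑ i, (β ⁅g, x i⁆ (y i) + β (x i) ⁅g, y i⁆) = 0) (v : V) :
    ⁅g, casimir F V x y v⁆ = casimir F V x y ⁅g, v⁆ := by
  have := h (LinearMap.mk₂ F (fun a b ↦ ⁅a, ⁅b, v⁆⁆) (by simp) (by simp) (by simp) (by simp))
  simp only [LinearMap.mk₂_apply] at this
  rw [casimir_apply, casimir_apply, lie_sum, ← sub_eq_zero, ← Finset.sum_sub_distrib, ← this]
  refine Finset.sum_congr rfl fun i _ ↦ ?_
  rw [leibniz_lie g (x i), leibniz_lie g (y i)]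
  simp

/-- Taking β(a, b) = ⁅a, f b⁆ instead, the cocycle identity exhibits the Casimir operator composed
with `f` as an explicit coboundary. -/
theorem IsOneCocycle.casimir_apply {f : G →ₗ[F] V} (hf : IsOneCocycle f) {x y : ι → G} (g : G)
    (h : ∀ β : G →ₗ[F] G →ₗ[F] V, ∑ i, (β ⁅g, x i⁆ (y i) + β (x i) ⁅g, y i⁆) = 0) :
    casimir F V x y (f g) = ⁅g, ∑ i, ⁅x i, f (y i)⁆⁆ := by
  have := h (LinearMap.mk₂ F (fun a b ↦ ⁅a, f b⁆) (by simp) (by simp) (by simp) (by simp))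
  simp only [LinearMap.mk₂_apply] at this
  rw [LieAlgebra.casimir_apply, lie_sum, ← sub_eq_zero, ← Finset.sum_sub_distrib, ← neg_eq_zero,
    ← Finset.sum_neg_distrib, ← this]
  refine Finset.sum_congr rfl fun i _ ↦ ?_
  rw [leibniz_lie g (x i), hf g (y i)]
  simp

end Casimir

/-! ### Whitehead's first lemma. -/

section Whitehead

variable {V : Type*} [CharZero F] [FiniteDimensional F G] [HasTrivialRadical F G]
  [AddCommGroup V] [Module F V] [LieRingModule G V] [LieModule F G V] [FiniteDimensional F V]

variable (F G V) in
/-- On an irreducible module, the radical of the trace form acts trivially. -/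
theorem lie_eq_zero_of_traceForm_eq_zero [IsIrreducible F G V] (I : LieIdeal F G)
    (hI : ∀ x ∈ I, ∀ y ∈ I, traceForm F G V x y = 0) {x : G} (hx : x ∈ I) (v : V) :
    ⁅x, v⁆ = 0 := by
  have := nontrivial_of_isIrreducible F G V
  have h0 : traceForm F I V = 0 := by
    ext ⟨a, ha⟩ ⟨b, hb⟩
    exact hI a ha b hb
  -- Cartan's criterion, then Engel: the derived ideal of `I`, which is `I` by perfectness, kills a
  -- nonzero vector. The vectors killed by `I` form a submodule, so irreducibility concludes.
  have hnil := isNilpotent_derivedSeries_of_traceForm_eq_zero h0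
  have hnt := nontrivial_max_triv_of_isNilpotent F (derivedSeries F I 1) V
  have hmem (x : G) (hx : x ∈ I) : (⟨x, hx⟩ : I) ∈ derivedSeries F I 1 := by
    rw [LieIdeal.derivedSeries_eq_derivedSeriesOfIdeal_comap, LieIdeal.mem_comap]
    rw [derivedSeriesOfIdeal_succ, derivedSeriesOfIdeal_zero, IsKilling.lie_ideal_self]
    exact hx
  let W : LieSubmodule F G V :=
    { carrier := {v | ∀ x ∈ I, ⁅x, v⁆ = 0}
      add_mem' := fun ha hb x hx ↦ by rw [lie_add, ha x hx, hb x hx, add_zero]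
      zero_mem' := fun x _ ↦ lie_zero x
      smul_mem' := fun c v hv x hx ↦ by rw [lie_smul, hv x hx, smul_zero]
      lie_mem := fun {g v} hv x hx ↦ by
        rw [leibniz_lie, hv x hx, lie_zero, add_zero]
        exact hv _ (lie_mem_left F G I x g hx) }
  have hW : W ≠ ⊥ := by
    obtain ⟨⟨w, hw⟩, hw0⟩ := exists_ne (0 : maxTrivSubmodule F (derivedSeries F I 1) V)
    intro hbot
    have : w ∈ W := fun x hx ↦ (mem_maxTrivSubmodule F _ V w).mp hw ⟨⟨x, hx⟩, hmem x hx⟩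
    rw [hbot, LieSubmodule.mem_bot] at this
    exact hw0 (Subtype.ext this)
  have hv : v ∈ W := ((eq_bot_or_eq_top W).resolve_left hW) ▸ LieSubmodule.mem_top v
  exact hv x hx

variable (F G V) in
/-- A non-trivial irreducible module admits an invertible Casimir operator. -/
theorem exists_casimir_bijective [IsIrreducible F G V] (h : ¬ IsTrivial G V) :
    ∃ (n : ℕ) (x y : Fin n → G),
      (∀ (g : G) (β : G →ₗ[F] G →ₗ[F] V), ∑ i, (β ⁅g, x i⁆ (y i) + β (x i) ⁅g, y i⁆) = 0) ∧
      Function.Bijective (casimir F V x y) := by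
  classical
  set T := traceForm F G V with hT
  let I : LieIdeal F G :=
    { LinearMap.ker T with
      lie_mem := fun {g a} ha ↦ by
        ext z
        have ha : T a = 0 := ha
        change T ⁅g, a⁆ z = 0
        rw [hT, traceForm_apply_lie_apply', ← hT, ha]
        simp }
  have hIT {a : G} : a ∈ I ↔ T a = 0 := Iff.rfl
  have hIV (a : G) (ha : a ∈ I) (v : V) : ⁅a, v⁆ = 0 :=
    lie_eq_zero_of_traceForm_eq_zero F G V I (fun a ha b _ ↦ by rw [← hT, hIT.mp ha]; rfl) ha v
  -- The trace form may degenerate on `G`, but not on this complement of its radical; the dual bases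
  -- are taken there.
  let J : LieIdeal F G := I.killingCompl
  have hc : IsCompl I J := I.isCompl_killingCompl
  let B : LinearMap.BilinForm F J := T.restrict J
  have hBapp (a b : J) : B a b = T a b := rfl
  have hsymm : B.IsSymm := ⟨fun a b ↦ traceForm_comm F G V a b⟩
  have hinv : B.lieInvariant G := fun g a b ↦ traceForm_apply_lie_apply' F G V g a b
  have hB : B.Nondegenerate := by
    refine hsymm.isRefl.nondegenerate_iff_separatingLeft.mpr fun a ha ↦ ?_
    have : (a : G) ∈ I := by
      rw [hIT]
      ext z
      obtain ⟨u, hu, w, hw, rfl⟩ : ∃ u ∈ I, ∃ w ∈ J, u + w = z := by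
        rw [← LieSubmodule.mem_sup, hc.sup_eq_top]; trivial
      rw [map_add, hT, traceForm_comm F G V a u, ← hT, hIT.mp hu]
      simpa [hBapp] using ha ⟨w, hw⟩
    have : (a : G) ∈ I ⊓ J := ⟨this, a.2⟩
    rw [hc.inf_eq_bot, LieSubmodule.mem_bot] at this
    exact Subtype.ext this
  let b := finBasis F J
  let d := B.dualBasis hB b
  have hinvt (g : G) (β : G →ₗ[F] G →ₗ[F] V) :
      ∑ i, (β ⁅g, (b i : G)⁆ (d i : G) + β (b i : G) ⁅g, (d i : G)⁆) = 0 :=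
    sum_dualBasis_lie_eq_zero hB hsymm hinv b
      (β.compl₁₂ J.toSubmodule.subtype J.toSubmodule.subtype) g
  set c := casimir F V (fun i ↦ (b i : G)) (fun i ↦ (d i : G)) with hcdef
  -- The trace is nonzero in characteristic zero, so `c` is nonzero and Schur's argument makes it
  -- bijective.
  have htr : LinearMap.trace F V c = finrank F J := by
    rw [hcdef, casimir, map_sum]
    have (i : Fin (finrank F J)) : LinearMap.trace F V (toEnd F G V (b i) ∘ₗ toEnd F G V (d i)) = 1 := by
      rw [← traceForm_apply_apply, ← hT, ← hBapp, B.apply_dualBasis_right hB hsymm, if_pos rfl]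
    simp [this]
  have hJ : J ≠ ⊥ := by
    intro hJ
    have hItop : I = ⊤ := by simpa [hJ] using hc.sup_eq_top
    exact h ⟨fun g v ↦ hIV g (hItop ▸ LieSubmodule.mem_top g) v⟩
  have hfr : finrank F J ≠ 0 := by
    intro h0
    exact hJ (LieSubmodule.toSubmodule_eq_bot J |>.mp (Submodule.finrank_eq_zero.mp h0))
  let K : LieSubmodule F G V :=
    { LinearMap.ker c with
      lie_mem := fun {g a} ha ↦ by
        change c ⁅g, a⁆ = 0
        have ha : c a = 0 := ha
        rw [hcdef, ← lie_casimir g (hinvt g), ← hcdef, ha, lie_zero] }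
  have hK : K = ⊥ := by
    refine (eq_bot_or_eq_top K).resolve_right fun hK ↦ ?_
    have : c = 0 := by
      ext v
      exact show v ∈ K from hK ▸ LieSubmodule.mem_top v
    rw [this, map_zero] at htr
    exact hfr (by exact_mod_cast htr.symm)
  have hinj : Function.Injective c := by
    rw [← LinearMap.ker_eq_bot, eq_bot_iff]
    intro v hv
    have : v ∈ K := hv
    rwa [hK] at this
  exact ⟨finrank F J, _, _, hinvt, hinj, LinearMap.surjective_of_injective hinj⟩

/-- **Whitehead's first lemma**: every 1-cocycle of a semisimple Lie algebra in characteristic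
zero with values in a finite-dimensional module is a coboundary. -/
theorem IsOneCocycle.exists_eq_lie {f : G →ₗ[F] V} (hf : IsOneCocycle f) :
    ∃ v : V, ∀ x : G, f x = ⁅x, v⁆ := by
  induction hn : finrank F V using Nat.strong_induction_on generalizing V with
  | _ n ih =>
  rcases subsingleton_or_nontrivial V with hV | hV
  · exact ⟨0, fun x ↦ Subsingleton.elim _ _⟩
  by_cases hirr : IsIrreducible F G V
  · by_cases htriv : IsTrivial G V
    · refine ⟨0, fun x ↦ ?_⟩
      rw [lie_zero]
      -- `G` is perfect, and a cocycle into a trivial module kills brackets.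
      have hx : x ∈ (⁅(⊤ : LieIdeal F G), (⊤ : LieIdeal F G)⁆ : LieIdeal F G).toSubmodule := by
        rw [IsKilling.lie_ideal_self]; trivial
      rw [LieSubmodule.lieIdeal_oper_eq_linear_span'] at hx
      refine (Submodule.span_le (p := LinearMap.ker f)).mpr ?_ hx
      rintro _ ⟨a, -, b, -, rfl⟩
      simp [hf a b, trivial_lie_zero]
    · obtain ⟨k, x, y, hinv, hinj, hsurj⟩ := exists_casimir_bijective F G V htriv
      obtain ⟨v, hv⟩ := hsurj (∑ i, ⁅x i, f (y i)⁆)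
      refine ⟨v, fun g ↦ hinj ?_⟩
      rw [hf.casimir_apply g (hinv g), ← lie_casimir g (hinv g), hv]
  · obtain ⟨W, hW0, hW1⟩ : ∃ W : LieSubmodule F G V, W ≠ ⊥ ∧ W ≠ ⊤ := by
      by_contra! hcon
      exact hirr (IsIrreducible.mk hcon)
    have hWlt : finrank F W < n := by
      rw [← hn]
      exact Submodule.finrank_lt (s := W.toSubmodule)
        (lt_top_iff_ne_top.mpr (by simpa using hW1)).ne
    have hQlt : finrank F (V ⧸ W) < n := by
      have h1 : finrank F (V ⧸ W) + finrank F W = finrank F V :=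
        Submodule.finrank_quotient_add_finrank W.toSubmodule
      have : Nontrivial W := (LieSubmodule.nontrivial_iff_ne_bot F G V).mpr hW0
      have h2 : 0 < finrank F W := finrank_pos
      omega
    have hfd : FiniteDimensional F (V ⧸ W) :=
      inferInstanceAs (FiniteDimensional F (V ⧸ W.toSubmodule))
    -- Solve modulo `W` first; subtracting the coboundary of a lift leaves a cocycle with values in
    -- `W`.
    let π : V →ₗ⁅F, G⁆ V ⧸ W := LieSubmodule.Quotient.mk' W
    obtain ⟨q, hq⟩ := ih _ hQlt (f := (π : V →ₗ[F] V ⧸ W) ∘ₗ f)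
      (fun x y ↦ by simp [hf x y]) rfl
    obtain ⟨v, rfl⟩ : ∃ v, π v = q := LieSubmodule.Quotient.surjective_mk' W q
    have hmem (x : G) : f x - ⁅x, v⁆ ∈ W.toSubmodule := by
      have : π (f x - ⁅x, v⁆) = 0 := by
        rw [map_sub, LieModuleHom.map_lie, ← hq x]
        simp
      exact (LieSubmodule.Quotient.mk_eq_zero W).mp this
    let f' : G →ₗ[F] W := LinearMap.codRestrict W.toSubmodule
      (f - (toEnd F G V : G →ₗ[F] Module.End F V).flip v) hmem
    have hf'v (x : G) : (f' x : V) = f x - ⁅x, v⁆ := rfl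
    obtain ⟨w, hw⟩ := ih _ hWlt (f := f') (fun x y ↦ Subtype.ext <| by
      rw [hf'v, LieSubmodule.coe_sub, LieSubmodule.coe_bracket, LieSubmodule.coe_bracket,
        hf'v, hf'v, hf x y, lie_sub, lie_sub, lie_lie]
      abel) rfl
    refine ⟨v + w, fun x ↦ ?_⟩
    have := congrArg (Subtype.val) (hw x)
    rw [hf'v, LieSubmodule.coe_bracket, sub_eq_iff_eq_add'] at this
    rw [this, lie_add]

end Whitehead

end LieAlgebra

/-! ### Leibniz kernel, left multiplications and Levi subalgebras. -/

namespace LeibnizAlgebra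

attribute [local instance] LieRing.ofAssociativeRing

section Basic

variable {F L : Type*} [Field F] [NonUnitalNonAssocRing L] [Module F L]

theorem mul_mem_prodSpan {A B : Submodule F L} {a b : L} (ha : a ∈ A) (hb : b ∈ B) :
    a * b ∈ prodSpan A B :=
  Submodule.subset_span ⟨a, ha, b, hb, rfl⟩

theorem prodSpan_le {A B C : Submodule F L} :
    prodSpan A B ≤ C ↔ ∀ a ∈ A, ∀ b ∈ B, a * b ∈ C := by
  refine ⟨fun h a ha b hb ↦ h (mul_mem_prodSpan ha hb), fun h ↦ Submodule.span_le.mpr ?_⟩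
  rintro _ ⟨a, ha, b, hb, rfl⟩
  exact h a ha b hb

variable [IsLeftLeibniz L]

theorem mul_mul_eq (x y z : L) : (x * y) * z = x * (y * z) - y * (x * z) := by
  rw [IsLeftLeibniz.leibniz x y z, add_sub_cancel_right]

/-- x(yy) = (xy)y + y(xy), the polarization of the square at xy and y. -/
theorem mul_mul_self_mem_leib (x y : L) : x * (y * y) ∈ leib F L := by
  have h : x * (y * y) = (x * y + y) * (x * y + y) - (x * y) * (x * y) - y * y := by
    rw [IsLeftLeibniz.leibniz x y y]
    simp only [mul_add, add_mul]
    abel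
  rw [h]
  exact Submodule.sub_mem _ (Submodule.sub_mem _ (Submodule.subset_span ⟨_, rfl⟩)
    (Submodule.subset_span ⟨_, rfl⟩)) (Submodule.subset_span ⟨_, rfl⟩)

variable [SMulCommClass F L L] [IsScalarTower F L L]

theorem leib_mul {k : L} (hk : k ∈ leib F L) (x : L) : k * x = 0 := by
  refine (Submodule.span_le (p := LinearMap.ker ((LinearMap.mul F L).flip x))).mpr ?_ hk
  rintro _ ⟨y, rfl⟩
  change y * y * x = 0
  rw [mul_mul_eq, sub_self]

theorem mul_leib (x : L) {k : L} (hk : k ∈ leib F L) : x * k ∈ leib F L := by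
  refine (Submodule.span_le (p := (leib F L).comap (LinearMap.mul F L x))).mpr ?_ hk
  rintro _ ⟨y, rfl⟩
  exact mul_mul_self_mem_leib x y

theorem isIdeal_leib : IsIdeal (leib F L) := fun k hk x ↦
  ⟨mul_leib x hk, by rw [leib_mul hk]; exact zero_mem _⟩

/-- A subspace whose derived series gets into the Leibniz kernel is solvable. -/
theorem isSolvable_of_derivedSeries_le_leib {A : Submodule F L} {n : ℕ}
    (h : derivedSeries A n ≤ leib F L) : IsSolvable A := by
  refine ⟨n + 1, le_bot_iff.mp (prodSpan_le.mpr fun a ha b _ ↦ ?_)⟩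
  rw [leib_mul (h ha)]
  exact zero_mem _

theorem isSolvable_leib : IsSolvable (leib F L) :=
  isSolvable_of_derivedSeries_le_leib (n := 0) le_rfl

theorem radical_eq_leib (hL : IsSemisimple F L) : radical F L = leib F L :=
  le_antisymm (sSup_le fun I hI ↦ hL I hI.1 hI.2) (le_sSup ⟨isIdeal_leib, isSolvable_leib⟩)

/-- In a semisimple left Leibniz algebra, the Leibniz kernel consists of all the elements with
vanishing left multiplication operator. -/
theorem ker_mul_eq_leib (hL : IsSemisimple F L) : LinearMap.ker (LinearMap.mul F L) = leib F L := by
  have hker {a : L} : a ∈ LinearMap.ker (LinearMap.mul F L) ↔ ∀ y, a * y = 0 :=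
    ⟨fun h y ↦ LinearMap.congr_fun h y, fun h ↦ LinearMap.ext h⟩
  -- The kernel is an ideal with zero product, hence solvable.
  refine le_antisymm (hL _ (fun a ha x ↦ ⟨?_, ?_⟩) ⟨1, ?_⟩) fun k hk ↦ hker.mpr (leib_mul hk)
  · refine hker.mpr fun y ↦ ?_
    rw [mul_mul_eq, hker.mp ha, hker.mp ha, mul_zero, sub_zero]
  · rw [hker.mp ha]
    exact zero_mem _
  · refine le_bot_iff.mp (prodSpan_le.mpr fun a ha b _ ↦ ?_)
    rw [hker.mp ha]
    exact zero_mem _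

/-- A Levi subalgebra and the Leibniz kernel grade a semisimple left Leibniz algebra. -/
theorem IsLeviSubalgebra.exists_isZ2Grading (hL : IsSemisimple F L) {s : NonUnitalSubalgebra F L}
    (hs : IsLeviSubalgebra s) :
    ∃ 𝒜 : ZMod 2 → Submodule F L,
      𝒜 0 = s.toSubmodule ∧ 𝒜 1 = leib F L ∧ IsZ2Grading 𝒜 := by
  have hcases : ∀ i : ZMod 2, i = 0 ∨ i = 1 := by decide
  let 𝒜 : ZMod 2 → Submodule F L := fun i ↦ if i = 0 then s.toSubmodule else leib F L
  have h0 : 𝒜 0 = s.toSubmodule := if_pos rfl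
  have h1 : 𝒜 1 = leib F L := if_neg (by decide)
  refine ⟨𝒜, h0, h1, ?_, fun i j a ha b hb ↦ ?_⟩
  · refine (DirectSum.isInternal_submodule_iff_isCompl 𝒜 (i := 0) (j := 1) (by decide)
      (Set.eq_univ_of_forall hcases).symm).mpr ?_
    rw [h0, h1, ← radical_eq_leib hL]
    exact hs.2.2
  · rcases hcases i with rfl | rfl
    · rw [h0] at ha
      rw [zero_add]
      rcases hcases j with rfl | rfl
      · rw [h0] at hb ⊢
        exact s.mul_mem ha hb
      · rw [h1] at hb ⊢
        exact mul_leib a hb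
    · rw [leib_mul (h1 ▸ ha)]
      exact zero_mem _

/-- A subalgebra that complements the Leibniz kernel of a semisimple left
Leibniz algebra is a Levi subalgebra. -/
theorem isLeviSubalgebra_of_isCompl_leib (hL : IsSemisimple F L) {s : NonUnitalSubalgebra F L}
    (hs : IsCompl s.toSubmodule (leib F L)) : IsLeviSubalgebra s := by
  refine ⟨fun x hx ↦ ?_, fun I hI hsol ↦ ?_, radical_eq_leib hL ▸ hs⟩
  · exact Submodule.disjoint_def.mp hs.disjoint _ (s.mul_mem hx hx) (Submodule.subset_span ⟨x, rfl⟩)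
  · obtain ⟨n, hn⟩ := hsol
    let ι : s →ₗ[F] L := s.toSubmodule.subtype
    -- Adding Leib(L) turns a solvable ideal of `s` into one of `L`; it then lies in Leib(L), which
    -- meets `s` trivially.
    have hle : I.map ι ⊔ leib F L ≤ leib F L := by
      refine hL _ (fun a ha x ↦ ?_) (isSolvable_of_derivedSeries_le_leib (n := n) ?_)
      · obtain ⟨_, ⟨c, hc, rfl⟩, k, hk, rfl⟩ := Submodule.mem_sup.mp ha
        obtain ⟨u, hu, l, hl, rfl⟩ : ∃ u ∈ s.toSubmodule, ∃ l ∈ leib F L, u + l = x := by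
          rw [← Submodule.mem_sup, hs.sup_eq_top]
          trivial
        constructor
        · rw [mul_add]
          refine Submodule.add_mem _ ?_ (Submodule.mem_sup_right (mul_leib _ hk))
          rw [add_mul, leib_mul hl, add_zero]
          exact Submodule.mem_sup_left ⟨_, (hI c hc ⟨u, hu⟩).1, rfl⟩
        · rw [add_mul, leib_mul hk, add_zero, mul_add]
          exact Submodule.add_mem _ (Submodule.mem_sup_left ⟨_, (hI c hc ⟨u, hu⟩).2, rfl⟩)
            (Submodule.mem_sup_right (mul_leib _ hl))
      · have key (m : ℕ) : derivedSeries (I.map ι ⊔ leib F L) m ≤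
            (derivedSeries I m).map ι ⊔ leib F L := by
          induction m with
          | zero => exact le_rfl
          | succ m ih =>
            refine prodSpan_le.mpr fun a ha b hb ↦ ?_
            obtain ⟨_, ⟨c, hc, rfl⟩, k, hk, rfl⟩ := Submodule.mem_sup.mp (ih ha)
            obtain ⟨_, ⟨d, hd, rfl⟩, l, hl, rfl⟩ := Submodule.mem_sup.mp (ih hb)
            rw [add_mul, leib_mul hk, add_zero, mul_add]
            exact Submodule.add_mem _ (Submodule.mem_sup_left ⟨_, mul_mem_prodSpan hc hd, rfl⟩)
              (Submodule.mem_sup_right (mul_leib _ hl))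
        simpa [hn] using key n
    intro a ha
    have h0 : (a : L) = 0 := Submodule.disjoint_def.mp hs.disjoint _ a.2
      (hle (Submodule.mem_sup_left ⟨a, ha, rfl⟩))
    have : a = 0 := Subtype.ext h0
    rw [this]
    exact zero_mem _

variable (F L) in
/-- The Lie algebra of left multiplication operators of a left Leibniz algebra. -/
def leftMul : LieSubalgebra F (Module.End F L) :=
  { LinearMap.range (LinearMap.mul F L) with
    lie_mem' := by
      rintro _ _ ⟨x, rfl⟩ ⟨y, rfl⟩
      refine ⟨x * y, LinearMap.ext fun z ↦ ?_⟩
      exact mul_mul_eq x y z }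

variable (F L) in
/-- The canonical map from a left Leibniz algebra onto its left multiplication operators. -/
def toLeftMul : L →ₗ[F] leftMul F L := (LinearMap.mul F L).rangeRestrict

theorem toLeftMul_surjective : Function.Surjective (toLeftMul F L) :=
  (LinearMap.mul F L).surjective_rangeRestrict

theorem toLeftMul_lie (x y : L) : ⁅toLeftMul F L x, y⁆ = x * y := rfl

theorem toLeftMul_mul (x y : L) : toLeftMul F L (x * y) = ⁅toLeftMul F L x, toLeftMul F L y⁆ :=
  Subtype.ext <| LinearMap.ext fun z ↦ mul_mul_eq x y z

theorem toLeftMul_lie' (g : leftMul F L) (y : L) : toLeftMul F L ⁅g, y⁆ = ⁅g, toLeftMul F L y⁆ := by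
  obtain ⟨x, rfl⟩ := toLeftMul_surjective g
  exact toLeftMul_mul x y

theorem toLeftMul_eq_zero (hL : IsSemisimple F L) {x : L} :
    toLeftMul F L x = 0 ↔ x ∈ leib F L := by
  rw [← ker_mul_eq_leib hL, LinearMap.mem_ker]
  exact Subtype.ext_iff

/-- The preimage of an abelian ideal is a solvable ideal of `L`, so it lies in the kernel Leib(L).
-/
theorem hasTrivialRadical_leftMul (hL : IsSemisimple F L) :
    LieAlgebra.HasTrivialRadical F (leftMul F L) := by
  rw [LieAlgebra.hasTrivialRadical_iff_no_abelian_ideals]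
  intro I hI
  rw [LieSubmodule.lie_abelian_iff_lie_self_eq_bot, LieSubmodule.lie_eq_bot_iff] at hI
  have hle : I.toSubmodule.comap (toLeftMul F L) ≤ leib F L := by
    refine hL _ (fun a ha x ↦ ⟨?_, ?_⟩) (isSolvable_of_derivedSeries_le_leib (n := 1) ?_)
    · rw [Submodule.mem_comap, toLeftMul_mul]
      exact lie_mem_right F _ I _ _ ha
    · rw [Submodule.mem_comap, toLeftMul_mul]
      exact lie_mem_left F _ I _ _ ha
    · refine prodSpan_le.mpr fun a ha b hb ↦ (toLeftMul_eq_zero hL).mp ?_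
      rw [toLeftMul_mul]
      exact hI _ ha _ hb
  rw [LieSubmodule.eq_bot_iff]
  intro g hg
  obtain ⟨x, rfl⟩ := toLeftMul_surjective g
  exact (toLeftMul_eq_zero hL).mpr (hle hg)

/-- The projection of a semisimple left Leibniz algebra to its left multiplication operators has
an equivariant section. -/
theorem exists_equivariant_section [CharZero F] [FiniteDimensional F L] (hL : IsSemisimple F L) :
    ∃ τ : leftMul F L →ₗ[F] L, (∀ g, toLeftMul F L (τ g) = g) ∧ ∀ g h : leftMul F L, τ ⁅g, h⁆ = ⁅g, τ h⁆ := by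
  have := hasTrivialRadical_leftMul hL
  have : FiniteDimensional F (leftMul F L) :=
    inferInstanceAs (FiniteDimensional F (LinearMap.range (LinearMap.mul F L)))
  obtain ⟨σ, hσ⟩ := (toLeftMul F L).exists_rightInverse_of_surjective
    (LinearMap.range_eq_top.mpr toLeftMul_surjective)
  replace hσ (g) : toLeftMul F L (σ g) = g := LinearMap.congr_fun hσ g
  let K : LieSubmodule F (leftMul F L) L :=
    { LinearMap.ker (toLeftMul F L) with
      lie_mem := fun {g k} hk ↦ by
        change toLeftMul F L ⁅g, k⁆ = 0
        have hk : toLeftMul F L k = 0 := hk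
        rw [toLeftMul_lie', hk, lie_zero] }
  -- The failure of `σ` to be equivariant, formally the coboundary of `σ`, but with values in Hom(G,
  -- K), where `σ` itself does not lie. Writing it as the coboundary of some `h` in Hom(G, K) makes
  -- `σ - h` equivariant.
  let f : leftMul F L →ₗ[F] (leftMul F L →ₗ[F] K) := LinearMap.mk₂ F
    (fun g h ↦ ⟨⁅g, σ h⁆ - σ ⁅g, h⁆, by
      change toLeftMul F L _ = 0
      rw [map_sub, toLeftMul_lie', hσ, hσ, sub_self]⟩)
    (fun a b c ↦ Subtype.ext (by simp; abel)) (fun a b c ↦ Subtype.ext (by simp [smul_sub]))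
    (fun a b c ↦ Subtype.ext (by simp; abel)) (fun a b c ↦ Subtype.ext (by simp [smul_sub]))
  have hfv (g h) : (f g h : L) = ⁅g, σ h⁆ - σ ⁅g, h⁆ := rfl
  have hf : LieAlgebra.IsOneCocycle f := by
    intro x y
    ext z
    simp only [LinearMap.sub_apply, LieHom.lie_apply, LieSubmodule.coe_sub,
      LieSubmodule.coe_bracket, hfv, lie_sub, lie_lie, map_sub]
    abel
  obtain ⟨h, hh⟩ := hf.exists_eq_lie
  refine ⟨σ - K.toSubmodule.subtype ∘ₗ h, fun g ↦ ?_, fun x y ↦ ?_⟩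
  · have : toLeftMul F L (h g) = 0 := (h g).2
    simp [hσ, this]
  · have := congrArg Subtype.val (LinearMap.congr_fun (hh x) y)
    rw [hfv, LieHom.lie_apply, LieSubmodule.coe_sub, LieSubmodule.coe_bracket] at this
    simp only [LinearMap.sub_apply, LinearMap.comp_apply, Submodule.subtype_apply, lie_sub]
    rw [sub_eq_sub_iff_add_eq_add] at this ⊢
    rw [add_comm, ← this]

theorem exists_isLeviSubalgebra [CharZero F] [FiniteDimensional F L] (hL : IsSemisimple F L) :
    ∃ s : NonUnitalSubalgebra F L, IsLeviSubalgebra s := by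
  obtain ⟨τ, hτ, hlie⟩ := exists_equivariant_section hL
  refine ⟨{ LinearMap.range τ with mul_mem' := ?_ }, isLeviSubalgebra_of_isCompl_leib hL ?_⟩
  · rintro _ _ ⟨g, rfl⟩ ⟨h, rfl⟩
    refine ⟨⁅g, h⁆, ?_⟩
    rw [hlie, ← toLeftMul_lie (F := F), hτ]
  · change IsCompl (LinearMap.range τ) (leib F L)
    refine ⟨Submodule.disjoint_def.mpr ?_, codisjoint_iff.mpr (eq_top_iff.mpr fun x _ ↦ ?_)⟩
    · rintro _ ⟨g, rfl⟩ hg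
      rw [← toLeftMul_eq_zero hL, hτ] at hg
      rw [hg, map_zero]
    · refine Submodule.mem_sup.mpr ⟨τ (toLeftMul F L x), ⟨_, rfl⟩, x - τ (toLeftMul F L x), ?_,
        add_sub_cancel _ _⟩
      rw [← toLeftMul_eq_zero hL, map_sub, hτ, sub_self]

end Basic

end LeibnizAlgebra

theorem proposition4p1 {F L : Type*} [Field F] [CharZero F]
    [NonUnitalNonAssocRing L] [Module F L] [SMulCommClass F L L] [IsScalarTower F L L]
    [LeibnizAlgebra.IsLeftLeibniz L] [FiniteDimensional F L]
    (hL : LeibnizAlgebra.IsSemisimple F L) :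
    (∃ s : NonUnitalSubalgebra F L, LeibnizAlgebra.IsLeviSubalgebra s) ∧
    ∀ s : NonUnitalSubalgebra F L, LeibnizAlgebra.IsLeviSubalgebra s →
      ∃ 𝒜 : ZMod 2 → Submodule F L,
        𝒜 0 = s.toSubmodule ∧ 𝒜 1 = LeibnizAlgebra.leib F L ∧
          LeibnizAlgebra.IsZ2Grading 𝒜 :=
  ⟨LeibnizAlgebra.exists_isLeviSubalgebra hL, fun _ hs ↦ hs.exists_isZ2Grading hL⟩
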